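/- Let $\Gamma$ be a finite, compact, connected metric tree: a finite connected graph without cycles, with vertex set $V$ and edge set $E$, in which each edge $e$ is identified with an interval $[0,\ell_e]$ of finite length $\ell_e>0$ whose end points are glued to the end vertices of $e$. The boundary of $\Gamma$ is the set of vertices of degree one. The standard (continuity–Kirchhoff) Laplacian $-\Delta_\Gamma$ is the operator in $L^2(\Gamma)=\bigoplus_{e\in E}L^2(0,\ell_e)$ that acts as $f\mapsto -f''$ on each edge, and whose domain consists of the functions $f$ on $\Gamma$ such that the restriction of $f$ to each edge $e$ belongs to $H^2(0,\ell_e)$, $f$ is continuous at every vertex, and at every vertex $v$ the sum of the outgoing derivatives of $f$ at $v$ along all edges incident to $v$ is zero. Let $\mu_2(\Gamma)$ be the smallest positive eigenvalue of $-\Delta_\Gamma$ and let $f:\Gamma\to\mathbb{R}$ be any (real-valued) eigenfunction of $-\Delta_\Gamma$ for the eigenvalue $\mu_2(\Gamma)$. Then every point of $\Gamma$ at which $f$ attains its global maximum and every point at which $f$ attains its global minimum is a boundary vertex, i.e. a vertex of degree one. -/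

import Mathlib

open MeasureTheory

/-- A finite, compact metric graph: a finite set `V` of vertices, a finite set `E` of edges, where
the edge `e` is the compact interval `[0, len e]` of finite positive length, glued with its end `0`
to the vertex `src e` and with its end `len e` to the vertex `tgt e`.
(Finiteness of `V` and `E` is assumed by instances where the structure is used.) -/
structure MetricGraph (V E : Type*) where
  /-- the vertex at the end `t = 0` of an edge -/
  src : E → V
  /-- the vertex at the end `t = len e` of an edge -/
  tgt : E → V
  /-- the length of an edge -/
  len : E → ℝ
  len_pos : ∀ e, 0 < len e

namespace MetricGraph

variable {V E : Type*} (Γ : MetricGraph V E)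

/-- The underlying simple graph: two distinct vertices are adjacent when some edge joins them. -/
def toSimpleGraph : SimpleGraph V :=
  SimpleGraph.fromRel (fun u v => ∃ e, Γ.src e = u ∧ Γ.tgt e = v)

/-- `Γ` is a (connected) tree: it has neither loops nor parallel edges (which would be cycles of
length one and two), and the underlying simple graph is connected and contains no cycle. -/
structure IsTree : Prop where
  no_loops : ∀ e, Γ.src e ≠ Γ.tgt e
  no_parallel : Function.Injective (fun e => s(Γ.src e, Γ.tgt e))
  isTree : Γ.toSimpleGraph.IsTree

/-- The points of the metric graph: the vertices and the interior points of the edges. -/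
inductive Point : Type _
  | vertex (v : V) : Point
  | inner (e : E) (t : ℝ) (h0 : 0 < t) (h1 : t < Γ.len e) : Point

variable {Γ}

/-- The point of `Γ` with coordinate `t ∈ [0, len e]` on the edge `e`, where the two ends of the
interval are identified with the end vertices of `e`. (Only `t ∈ [0, len e]` matters.) -/
noncomputable def Point.onEdge (e : E) (t : ℝ) : Γ.Point :=
  if h0 : 0 < t then
    if h1 : t < Γ.len e then Point.inner e t h0 h1 else Point.vertex (Γ.tgt e)
  else Point.vertex (Γ.src e)

variable (Γ)

open Classical in
/-- The degree of a vertex: the number of edge ends at that vertex. -/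
noncomputable def degree [Fintype E] (v : V) : ℕ :=
  (Finset.univ.filter (fun e => Γ.src e = v)).card +
    (Finset.univ.filter (fun e => Γ.tgt e = v)).card

/-- The boundary of `Γ`: the set of the vertices of degree one. -/
def boundary [Fintype E] : Set Γ.Point :=
  {x | ∃ v : V, Γ.degree v = 1 ∧ x = Point.vertex v}

/-- `u` belongs to the Sobolev space `H²(0, ℓ)` (identified with its representative that is
continuous on `[0, ℓ]`), with first derivative `p` (its continuous representative on `[0, ℓ]`) and
second weak derivative `q ∈ L²(0, ℓ)`: that is, `u` and `p` are absolutely continuous on `[0, ℓ]`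
with `u' = p` and `p' = q` almost everywhere. -/
structure IsH2 (ℓ : ℝ) (u p q : ℝ → ℝ) : Prop where
  memLp : MemLp q 2 (volume.restrict (Set.Icc 0 ℓ))
  integral_p : ∀ t ∈ Set.Icc 0 ℓ, u t = u 0 + ∫ s in (0 : ℝ)..t, p s
  integral_q : ∀ t ∈ Set.Icc 0 ℓ, p t = p 0 + ∫ s in (0 : ℝ)..t, q s

open Classical in
/-- `f` belongs to the domain of the standard Laplacian `-Δ_Γ` in `L²(Γ)`, and `-Δ_Γ f = g`:
* on each edge `f` is in `H²`. Here `f` is a function on `Γ`, all of whose restrictions to the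
  closed edges are continuous, so that `f` is continuous at the vertices;
* at each vertex the sum of the outgoing derivatives of `f` along all the edge ends at this vertex
  vanishes (Kirchhoff condition);
* `-f'' = g` almost everywhere on each edge. -/
def HasNegLaplacian [Fintype E] (f g : Γ.Point → ℝ) : Prop :=
  ∃ p q : E → ℝ → ℝ,
    (∀ e, IsH2 (Γ.len e) (fun t => f (Point.onEdge e t)) (p e) (q e)) ∧
    (∀ v : V, (∑ e with Γ.src e = v, p e 0) + (∑ e with Γ.tgt e = v, -(p e (Γ.len e))) = 0) ∧
    (∀ e, ∀ᵐ t ∂(volume.restrict (Set.Icc 0 (Γ.len e))), -(q e t) = g (Point.onEdge e t))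

/-- `f` is a (real) eigenfunction of the standard Laplacian `-Δ_Γ` for the eigenvalue `μ`: it is in
the domain, satisfies `-Δ_Γ f = μ f`, and is not the zero element of `L²(Γ)`. -/
def IsEigenfunction [Fintype E] (μ : ℝ) (f : Γ.Point → ℝ) : Prop :=
  Γ.HasNegLaplacian f (fun x => μ * f x) ∧
    ¬ ∀ e, ∀ᵐ t ∂(volume.restrict (Set.Icc 0 (Γ.len e))), f (Point.onEdge e t) = 0

/-- `μ` is the first (least) positive eigenvalue `μ₂(Γ)` of the standard Laplacian on `Γ`. -/
def IsFirstPositiveEigenvalue [Fintype E] (μ : ℝ) : Prop :=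
  IsLeast {ν : ℝ | 0 < ν ∧ ∃ f, Γ.IsEigenfunction ν f} μ

end MetricGraph

/-!
A point `x` of a tree that is not a boundary vertex separates it into two nondegenerate sides. Let a
solution `u` of `-u'' = μ u` have its maximum `M` at `x`. Then all its derivatives at `x` vanish (at
a vertex, the outgoing derivatives are nonpositive and have sum zero), so the restrictions `G₁`,
`G₂` of `M - u` to the two sides, extended by zero, are continuous and edgewise `C¹`. Testing the
equation for `u` with `Gᵢ` gives `∫ Gᵢ'² = μ ∫ Gᵢ² - μ M ∫ Gᵢ`, where `M > 0` because `u` has mean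
zero, and `∫ Gᵢ > 0`. The combination `G₁ + s G₂` of mean zero therefore has a Rayleigh quotient
below `μ` (`Solves.exists_trial`), which by the variational principle gives an eigenvalue in `(0,
μ)`. If `μ` is the least positive eigenvalue, this is absurd. Minima are maxima of `-u`.

The variational principle is proved without compactness or Sobolev spaces
(`exists_isEigenfunction_lt`). Let `R` be the infimum of the Rayleigh quotients of the `C¹`
functions of mean zero; it is positive by a Poincaré inequality (`exists_poincare`). If `R` is not
an eigenvalue, then `-w'' = R w + g` is solvable with a bound on `∫ g w`: edgewise it is solved by
Duhamel's formula, and the vertex conditions are then met by solving a linear system for the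
finitely many initial data, which is injective and hence invertible
(`exists_solves_of_not_isEigenfunction`). Inserting `u - s w`, with `g = u`, into `R ∫ u² ≤ ∫ u'²`
improves `R` to `R + s`, a contradiction.

Classical solutions and the eigenfunctions of the statement are matched by
`IsEigenfunction.exists_solves`, as an `H²` solution of `-u'' = μ u` is trigonometric on each edge,
and `Solves.eq_zero_of_not_isEigenfunction`.
-/

namespace MetricGraph

section

variable {V E : Type*} (Γ : MetricGraph V E)

/-! ### Integrals and differentiable functions on the edges -/

/-- The integral over `Γ` of a family of functions, one for each edge. -/
noncomputable def total [Fintype E] (g : E → ℝ → ℝ) : ℝ :=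
  ∑ e, ∫ t in (0 : ℝ)..Γ.len e, g e t

/-- A continuous, edgewise `C¹` function on `Γ` with vertex values `φ`, edge functions `u` and edge
derivatives `p`. The edge functions are taken to be defined (and `C¹`) on all of `ℝ`; only their
values on `[0, len e]` carry a meaning on `Γ`. -/
structure IsC1 (φ : V → ℝ) (u p : E → ℝ → ℝ) : Prop where
  hasDeriv : ∀ e t, HasDerivAt (u e) (p e t) t
  cont : ∀ e, Continuous (p e)
  src : ∀ e, u e 0 = φ (Γ.src e)
  tgt : ∀ e, u e (Γ.len e) = φ (Γ.tgt e)

open Classical in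
/-- The function with vertex values `φ`, edge functions `u` and edge derivatives `p` is a classical
solution of `-u'' = ν u + g` with the continuity and Kirchhoff conditions at the vertices. -/
structure Solves [Fintype E] (ν : ℝ) (g : E → ℝ → ℝ) (φ : V → ℝ) (u p : E → ℝ → ℝ) : Prop
    extends Γ.IsC1 φ u p where
  hasDeriv_p : ∀ e t, HasDerivAt (p e) (-(ν * u e t) - g e t) t
  kirchhoff : ∀ v : V,
    (∑ e with Γ.src e = v, p e 0) + (∑ e with Γ.tgt e = v, -(p e (Γ.len e))) = 0

variable {Γ}

theorem IsC1.continuous {φ : V → ℝ} {u p : E → ℝ → ℝ} (h : Γ.IsC1 φ u p) (e : E) :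
    Continuous (u e) :=
  continuous_iff_continuousAt.2 fun t => (h.hasDeriv e t).continuousAt

theorem IsC1.add_smul {φ ψ : V → ℝ} {u p w q : E → ℝ → ℝ} (h : Γ.IsC1 φ u p)
    (h' : Γ.IsC1 ψ w q) (s : ℝ) :
    Γ.IsC1 (fun v => φ v + s * ψ v) (fun e t => u e t + s * w e t)
      (fun e t => p e t + s * q e t) where
  hasDeriv e t := (h.hasDeriv e t).add ((h'.hasDeriv e t).const_mul s)
  cont e := (h.cont e).add (continuous_const.mul (h'.cont e))
  src e := by rw [h.src, h'.src]
  tgt e := by rw [h.tgt, h'.tgt]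

theorem isC1_const (c : ℝ) : Γ.IsC1 (fun _ => c) (fun _ _ => c) (fun _ _ => 0) where
  hasDeriv _ t := hasDerivAt_const t c
  cont _ := continuous_const
  src _ := rfl
  tgt _ := rfl

variable [Fintype E]

theorem total_add {g h : E → ℝ → ℝ} (hg : ∀ e, Continuous (g e)) (hh : ∀ e, Continuous (h e)) :
    Γ.total (fun e t => g e t + h e t) = Γ.total g + Γ.total h := by
  unfold total
  rw [← Finset.sum_add_distrib]
  exact Finset.sum_congr rfl fun e _ => intervalIntegral.integral_add
    ((hg e).intervalIntegrable _ _) ((hh e).intervalIntegrable _ _)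

theorem total_const_mul (c : ℝ) (g : E → ℝ → ℝ) :
    Γ.total (fun e t => c * g e t) = c * Γ.total g := by
  unfold total
  rw [Finset.mul_sum]
  exact Finset.sum_congr rfl fun e _ => intervalIntegral.integral_const_mul _ _

theorem total_mono {g h : E → ℝ → ℝ} (hg : ∀ e, Continuous (g e)) (hh : ∀ e, Continuous (h e))
    (hgh : ∀ e, ∀ t ∈ Set.Icc 0 (Γ.len e), g e t ≤ h e t) : Γ.total g ≤ Γ.total h :=
  Finset.sum_le_sum fun e _ => intervalIntegral.integral_mono_on (Γ.len_pos e).le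
    ((hg e).intervalIntegrable _ _) ((hh e).intervalIntegrable _ _) (hgh e)

theorem total_nonneg {g : E → ℝ → ℝ} (hg : ∀ e, ∀ t ∈ Set.Icc 0 (Γ.len e), 0 ≤ g e t) :
    0 ≤ Γ.total g :=
  Finset.sum_nonneg fun e _ => intervalIntegral.integral_nonneg (Γ.len_pos e).le (hg e)

theorem total_congr {g h : E → ℝ → ℝ} (hgh : ∀ e t, g e t = h e t) : Γ.total g = Γ.total h := by
  rw [show g = h from funext fun e => funext fun t => hgh e t]

/-- The Cauchy–Schwarz inequality for the integral of `|g|` over one edge. -/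
theorem sq_integral_abs_le {ℓ : ℝ} (hℓ : 0 < ℓ) {g : ℝ → ℝ} (hg : Continuous g) :
    (∫ t in (0 : ℝ)..ℓ, |g t|) ^ 2 ≤ ℓ * ∫ t in (0 : ℝ)..ℓ, g t ^ 2 := by
  set A := ∫ t in (0 : ℝ)..ℓ, |g t| with hA
  -- the variance of `|g|` around its mean `A / ℓ` is nonnegative
  have h0 : 0 ≤ ∫ t in (0 : ℝ)..ℓ, (|g t| - A / ℓ) ^ 2 :=
    intervalIntegral.integral_nonneg hℓ.le fun t _ => sq_nonneg _
  have h1 : ∫ t in (0 : ℝ)..ℓ, (|g t| - A / ℓ) ^ 2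
      = (∫ t in (0 : ℝ)..ℓ, g t ^ 2) - 2 * (A / ℓ) * A + (A / ℓ) ^ 2 * ℓ := by
    have h2 : ∀ t, (|g t| - A / ℓ) ^ 2 = (g t ^ 2 - 2 * (A / ℓ) * |g t|) + (A / ℓ) ^ 2 := by
      intro t
      rw [← sq_abs (g t)]; ring
    simp_rw [h2]
    rw [intervalIntegral.integral_add, intervalIntegral.integral_sub,
      intervalIntegral.integral_const_mul, ← hA]
    · simp [mul_comm]
    all_goals exact Continuous.intervalIntegrable (by fun_prop) _ _
  rw [h1] at h0
  have h3 : (∫ t in (0 : ℝ)..ℓ, g t ^ 2) - 2 * (A / ℓ) * A + (A / ℓ) ^ 2 * ℓ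
      = ((ℓ * ∫ t in (0 : ℝ)..ℓ, g t ^ 2) - A ^ 2) / ℓ := by
    field_simp; ring
  rw [h3] at h0
  have := mul_nonneg h0 hℓ.le
  rw [div_mul_cancel₀ _ hℓ.ne'] at this
  linarith

/-- The Cauchy–Schwarz inequality for the integral of `|g|` over `Γ`. -/
theorem sq_total_abs_le {g : E → ℝ → ℝ} (hg : ∀ e, Continuous (g e)) :
    Γ.total (fun e t => |g e t|) ^ 2 ≤ (∑ e, Γ.len e) * Γ.total (fun e t => g e t ^ 2) :=
  Finset.sum_sq_le_sum_mul_sum_of_sq_le_mul _ (fun e _ => (Γ.len_pos e).le)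
    (fun e _ => intervalIntegral.integral_nonneg (Γ.len_pos e).le fun _ _ => sq_nonneg _)
    (fun e _ => sq_integral_abs_le (Γ.len_pos e) (hg e))

/-- An integral over a part of an edge is at most the integral over `Γ` of a larger modulus. -/
theorem abs_integral_le_total {g h : E → ℝ → ℝ} (hg : ∀ e, Continuous (g e))
    (hh : ∀ e, Continuous (h e)) (hgh : ∀ e t, |h e t| ≤ |g e t|) (e : E) {t : ℝ}
    (ht : t ∈ Set.Icc 0 (Γ.len e)) :
    |∫ s in (0 : ℝ)..t, h e s| ≤ Γ.total (fun e t => |g e t|) := by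
  have hi : ∀ a b, IntervalIntegrable (fun s => |g e s|) volume a b :=
    fun a b => (hg e).abs.intervalIntegrable _ _
  calc |∫ s in (0 : ℝ)..t, h e s| ≤ ∫ s in (0 : ℝ)..t, |h e s| :=
        intervalIntegral.abs_integral_le_integral_abs ht.1
    _ ≤ ∫ s in (0 : ℝ)..t, |g e s| := intervalIntegral.integral_mono_on ht.1
        ((hh e).abs.intervalIntegrable _ _) (hi _ _) fun s _ => hgh e s
    _ ≤ ∫ s in (0 : ℝ)..Γ.len e, |g e s| := by
        rw [← intervalIntegral.integral_add_adjacent_intervals (hi 0 t) (hi t (Γ.len e))]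
        have := intervalIntegral.integral_nonneg (μ := volume) ht.2
          (fun s _ => abs_nonneg (g e s))
        linarith
    _ ≤ Γ.total (fun e t => |g e t|) :=
        Finset.single_le_sum (f := fun e => ∫ s in (0 : ℝ)..Γ.len e, |g e s|)
          (fun e _ => intervalIntegral.integral_nonneg (Γ.len_pos e).le fun _ _ => abs_nonneg _)
          (Finset.mem_univ e)

theorem IsC1.abs_sub_le_total {φ : V → ℝ} {u p : E → ℝ → ℝ} (h : Γ.IsC1 φ u p) (e : E) {t : ℝ}
    (ht : t ∈ Set.Icc 0 (Γ.len e)) :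
    |u e t - u e 0| ≤ Γ.total (fun e t => |p e t|) := by
  rw [← intervalIntegral.integral_eq_sub_of_hasDerivAt (fun s _ => h.hasDeriv e s)
    ((h.cont e).intervalIntegrable _ _)]
  exact abs_integral_le_total h.cont h.cont (fun _ _ => le_rfl) e ht

/-- The weak form of the equation: the boundary terms of the integrations by parts on the edges
cancel by the Kirchhoff condition for `w` and the continuity of the test function `u`. -/
theorem Solves.weak_form [Fintype V] {ν : ℝ} {g : E → ℝ → ℝ} {φ ψ : V → ℝ} {w p u q : E → ℝ → ℝ}
    (hw : Γ.Solves ν g φ w p) (hg : ∀ e, Continuous (g e)) (hu : Γ.IsC1 ψ u q) :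
    Γ.total (fun e t => p e t * q e t)
      = ν * Γ.total (fun e t => w e t * u e t) + Γ.total (fun e t => g e t * u e t) := by
  classical
  have cw := hw.toIsC1.continuous
  have cu := hu.continuous
  have cp := hw.cont
  have cq := hu.cont
  rw [← total_const_mul, ← total_add (by fun_prop) (by fun_prop), ← sub_eq_zero]
  unfold total
  rw [← Finset.sum_sub_distrib]
  have key : ∀ e, (∫ t in (0 : ℝ)..Γ.len e, p e t * q e t)
      - (∫ t in (0 : ℝ)..Γ.len e, (ν * (w e t * u e t) + g e t * u e t))
      = p e (Γ.len e) * ψ (Γ.tgt e) - p e 0 * ψ (Γ.src e) := by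
    intro e
    rw [← intervalIntegral.integral_sub (Continuous.intervalIntegrable (by fun_prop) _ _)
      (Continuous.intervalIntegrable (by fun_prop) _ _), ← hu.src, ← hu.tgt]
    refine intervalIntegral.integral_eq_sub_of_hasDerivAt (f := fun t => p e t * u e t)
      (fun t _ => ?_) (Continuous.intervalIntegrable (by fun_prop) _ _)
    exact ((hw.hasDeriv_p e t).mul (hu.hasDeriv e t)).congr_deriv (by ring)
  rw [Finset.sum_congr rfl fun e _ => key e, Finset.sum_sub_distrib]
  have h1 : ∑ e, p e (Γ.len e) * ψ (Γ.tgt e)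
      = ∑ v, (∑ e with Γ.tgt e = v, p e (Γ.len e)) * ψ v := by
    rw [← Finset.sum_fiberwise Finset.univ Γ.tgt]
    refine Finset.sum_congr rfl fun v _ => ?_
    rw [Finset.sum_mul]
    refine Finset.sum_congr rfl fun e he => ?_
    rw [(Finset.mem_filter.1 he).2]
  have h2 : ∑ e, p e 0 * ψ (Γ.src e)
      = ∑ v, (∑ e with Γ.src e = v, p e 0) * ψ v := by
    rw [← Finset.sum_fiberwise Finset.univ Γ.src]
    refine Finset.sum_congr rfl fun v _ => ?_
    rw [Finset.sum_mul]
    refine Finset.sum_congr rfl fun e he => ?_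
    rw [(Finset.mem_filter.1 he).2]
  rw [h1, h2, ← Finset.sum_sub_distrib]
  refine Finset.sum_eq_zero fun v _ => ?_
  have := hw.kirchhoff v
  rw [Finset.sum_neg_distrib] at this
  rw [← sub_mul, show (∑ e with Γ.tgt e = v, p e (Γ.len e)) - ∑ e with Γ.src e = v, p e 0 = 0 by
    convert (neg_eq_zero.2 this) using 1; ring, zero_mul]

end

section

variable {V E : Type*} {Γ : MetricGraph V E}

/-! ### The Poincaré inequality -/

theorem exists_edge_of_adj {v w : V} (h : Γ.toSimpleGraph.Adj v w) :
    ∃ e, (Γ.src e = v ∧ Γ.tgt e = w) ∨ (Γ.src e = w ∧ Γ.tgt e = v) := by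
  rw [toSimpleGraph, SimpleGraph.fromRel_adj] at h
  rcases h.2 with ⟨e, he⟩ | ⟨e, he⟩
  exacts [⟨e, Or.inl he⟩, ⟨e, Or.inr he⟩]

variable [Fintype E]

/-- The oscillation of the vertex values is controlled by the total variation, the constant being
the length of a walk between the two vertices. -/
theorem exists_abs_sub_le_total {v w : V} (h : Γ.toSimpleGraph.Reachable v w) :
    ∃ C : ℝ, 0 ≤ C ∧ ∀ φ u p, Γ.IsC1 φ u p →
      |φ v - φ w| ≤ C * Γ.total (fun e t => |p e t|) := by
  obtain ⟨W⟩ := h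
  induction W with
  | nil => exact ⟨0, le_rfl, fun φ u p _ => by simp⟩
  | @cons a b c hab W ih =>
    obtain ⟨C, hC, ih⟩ := ih
    refine ⟨C + 1, by positivity, fun φ u p hu => ?_⟩
    obtain ⟨e, he⟩ := exists_edge_of_adj hab
    have h1 := hu.abs_sub_le_total e (Set.right_mem_Icc.2 (Γ.len_pos e).le)
    rw [hu.src, hu.tgt] at h1
    have h2 : |φ a - φ b| ≤ Γ.total (fun e t => |p e t|) := by
      rcases he with ⟨rfl, rfl⟩ | ⟨rfl, rfl⟩
      · rwa [abs_sub_comm]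
      · exact h1
    have h3 := abs_sub_le (φ a) (φ b) (φ c)
    have h4 := ih φ u p hu
    linarith

theorem exists_poincare [Fintype V] (h : Γ.toSimpleGraph.Connected) :
    ∃ C : ℝ, 0 < C ∧ ∀ φ u p, Γ.IsC1 φ u p → Γ.total u = 0 →
      Γ.total (fun e t => u e t ^ 2) ≤ C * Γ.total (fun e t => p e t ^ 2) := by
  obtain ⟨v₀⟩ := h.nonempty
  choose C hC hCu using fun v => exists_abs_sub_le_total (h.preconnected v v₀)
  set K : ℝ := 1 + ∑ v, C v with hK
  have hCK : ∀ v, C v + 1 ≤ K := fun v => by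
    have := Finset.single_le_sum (f := C) (fun v _ => hC v) (Finset.mem_univ v)
    linarith
  set L : ℝ := ∑ e, Γ.len e with hL
  have hL0 : 0 ≤ L := Finset.sum_nonneg fun e _ => (Γ.len_pos e).le
  have hK0 : 0 ≤ K := by
    have := hCK v₀
    have := hC v₀
    linarith
  refine ⟨K ^ 2 * L * L + 1, by positivity, fun φ u p hu h0 => ?_⟩
  set N := Γ.total (fun e t => |p e t|) with hN
  have cu := hu.continuous
  have cp := hu.cont
  have hN0 : 0 ≤ N := total_nonneg fun e t _ => abs_nonneg _
  have hbound : ∀ e, ∀ t ∈ Set.Icc 0 (Γ.len e), |u e t - φ v₀| ≤ K * N := fun e t ht => by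
    have h1 := hu.abs_sub_le_total e ht
    have h2 := hCu (Γ.src e) φ u p hu
    rw [← hu.src] at h2
    have h3 := abs_sub_le (u e t) (u e 0) (φ v₀)
    have h4 := mul_le_mul_of_nonneg_right (hCK (Γ.src e)) hN0
    linarith
  -- subtracting a constant from a function of mean zero increases its norm
  have h1 : Γ.total (fun e t => u e t ^ 2) ≤ Γ.total (fun e t => (u e t - φ v₀) ^ 2) := by
    have : Γ.total (fun e t => u e t ^ 2) + -(2 * φ v₀) * Γ.total u
        ≤ Γ.total (fun e t => (u e t - φ v₀) ^ 2) := by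
      rw [← total_const_mul, ← total_add (by fun_prop) (by fun_prop)]
      exact total_mono (by fun_prop) (by fun_prop) fun e t _ => by nlinarith [sq_nonneg (φ v₀)]
    simpa [h0] using this
  have h2 : Γ.total (fun e t => (u e t - φ v₀) ^ 2) ≤ Γ.total (fun _ _ => (K * N) ^ 2) :=
    total_mono (by fun_prop) (by fun_prop) fun e t ht =>
      sq_le_sq' (abs_le.1 (hbound e t ht)).1 (abs_le.1 (hbound e t ht)).2
  have h3 : Γ.total (fun _ _ => (K * N) ^ 2) = L * (K * N) ^ 2 := by
    simp [total, hL, Finset.sum_mul]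
  have h4 := mul_le_mul_of_nonneg_left (sq_total_abs_le (Γ := Γ) cp)
    (show 0 ≤ K ^ 2 * L by positivity)
  rw [← hN, ← hL] at h4
  have h5 : 0 ≤ Γ.total (fun e t => p e t ^ 2) := total_nonneg fun e t _ => sq_nonneg _
  nlinarith

end

section

variable {V E : Type*} {Γ : MetricGraph V E}

/-! ### Classical solutions and eigenfunctions -/

theorem Point.onEdge_zero (e : E) : (Point.onEdge e 0 : Γ.Point) = .vertex (Γ.src e) := by
  simp [Point.onEdge]

theorem Point.onEdge_len (e : E) :
    (Point.onEdge e (Γ.len e) : Γ.Point) = .vertex (Γ.tgt e) := by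
  simp [Point.onEdge, Γ.len_pos e]

/-- The function on `Γ` with given vertex values and given functions on the open edges. -/
def glue (φ : V → ℝ) (u : E → ℝ → ℝ) : Γ.Point → ℝ
  | .vertex v => φ v
  | .inner e t _ _ => u e t

theorem IsC1.glue_onEdge {φ : V → ℝ} {u p : E → ℝ → ℝ} (h : Γ.IsC1 φ u p) (e : E) {t : ℝ}
    (ht : t ∈ Set.Icc 0 (Γ.len e)) : glue φ u (Point.onEdge (Γ := Γ) e t) = u e t := by
  unfold Point.onEdge
  split_ifs with h0 h1
  · rfl
  · rw [le_antisymm ht.2 (not_lt.1 h1), h.tgt]; rfl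
  · rw [le_antisymm (not_lt.1 h0) ht.1, h.src]; rfl

variable [Fintype E]

/-- A classical solution of the homogeneous equation vanishes if `ν` is not an eigenvalue. -/
theorem Solves.eq_zero_of_not_isEigenfunction {ν : ℝ} {φ : V → ℝ} {u p : E → ℝ → ℝ}
    (h : Γ.Solves ν (fun _ _ => 0) φ u p) (hν : ¬ ∃ f, Γ.IsEigenfunction ν f) (e : E) {t : ℝ}
    (ht : t ∈ Set.Icc 0 (Γ.len e)) : u e t = 0 := by
  have cu := h.toIsC1.continuous
  have cp := h.cont
  by_contra hne
  refine hν ⟨glue φ u, ⟨p, fun e t => -(ν * u e t), fun e => ⟨?_, ?_, ?_⟩, h.kirchhoff, ?_⟩, ?_⟩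
  · have hc : Continuous fun t => -(ν * u e t) := by fun_prop
    refine (memLp_top_of_bound hc.aestronglyMeasurable
      (sSup ((fun t => ‖-(ν * u e t)‖) '' Set.Icc 0 (Γ.len e))) ?_).mono_exponent le_top
    refine (ae_restrict_iff' measurableSet_Icc).2 (Filter.Eventually.of_forall fun t ht => ?_)
    exact le_csSup (isCompact_Icc.image hc.norm).bddAbove (Set.mem_image_of_mem _ ht)
  · intro t ht
    rw [h.glue_onEdge e ht, h.glue_onEdge e (Set.left_mem_Icc.2 (Γ.len_pos e).le),
      intervalIntegral.integral_eq_sub_of_hasDerivAt (fun s _ => h.hasDeriv e s)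
        ((cp e).intervalIntegrable _ _)]
    ring
  · intro t ht
    rw [intervalIntegral.integral_eq_sub_of_hasDerivAt
      (fun s _ => (h.hasDeriv_p e s).congr_deriv (sub_zero _))
        (Continuous.intervalIntegrable (by fun_prop) _ _)]
    ring
  · intro e
    refine (ae_restrict_iff' measurableSet_Icc).2 (Filter.Eventually.of_forall fun t ht => ?_)
    simp only [neg_neg, h.glue_onEdge e ht]
  · intro h0
    refine hne (Measure.eqOn_Icc_of_ae_eq volume (Γ.len_pos e).ne (g := fun _ => (0 : ℝ)) ?_
      (cu e).continuousOn continuousOn_const ht)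
    filter_upwards [h0 e, ae_restrict_mem measurableSet_Icc] with s hs hs'
    rwa [h.glue_onEdge e hs'] at hs

theorem hasDerivAt_sin_const_mul (k t : ℝ) :
    HasDerivAt (fun t => Real.sin (k * t)) (k * Real.cos (k * t)) t :=
  (((hasDerivAt_id t).const_mul k).sin).congr_deriv (by simp [mul_comm])

theorem hasDerivAt_cos_const_mul (k t : ℝ) :
    HasDerivAt (fun t => Real.cos (k * t)) (-(k * Real.sin (k * t))) t :=
  (((hasDerivAt_id t).const_mul k).cos).congr_deriv (by simp [mul_comm])

/-- The solutions of `u'' = -k² u` are trigonometric functions. -/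
theorem eqOn_trig_of_deriv {k ℓ : ℝ} (hk : 0 < k) (hℓ : 0 < ℓ) {u p : ℝ → ℝ}
    (hu : ∀ t ∈ Set.Icc 0 ℓ, HasDerivWithinAt u (p t) (Set.Icc 0 ℓ) t)
    (hp : ∀ t ∈ Set.Icc 0 ℓ, HasDerivWithinAt p (-(k ^ 2 * u t)) (Set.Icc 0 ℓ) t) :
    ∀ t ∈ Set.Icc 0 ℓ, u t = u 0 * Real.cos (k * t) + p 0 * (Real.sin (k * t) / k) ∧
      p t = -(k * u 0 * Real.sin (k * t)) + p 0 * Real.cos (k * t) := by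
  have hs := hasDerivAt_sin_const_mul k
  have hc := hasDerivAt_cos_const_mul k
  -- the two coordinates of `(k u, p)` in the rotating frame are conserved
  have hconst : ∀ f : ℝ → ℝ, (∀ t ∈ Set.Icc 0 ℓ, HasDerivWithinAt f 0 (Set.Icc 0 ℓ) t) →
      ∀ t ∈ Set.Icc 0 ℓ, f t = f 0 := fun f hf t ht =>
    (convex_Icc (0 : ℝ) ℓ).is_const_of_fderivWithin_eq_zero (𝕜 := ℝ)
      (fun s hs => (hf s hs).differentiableWithinAt) (fun s hs => by
        simpa using (hf s hs).hasFDerivWithinAt.fderivWithin (uniqueDiffOn_Icc hℓ s hs))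
      ht ⟨le_rfl, hℓ.le⟩
  intro t ht
  have h1 := hconst (fun t => k * u t * Real.cos (k * t) - p t * Real.sin (k * t)) (fun t ht =>
    ((((hu t ht).const_mul k).mul (hc t).hasDerivWithinAt).sub
      ((hp t ht).mul (hs t).hasDerivWithinAt)).congr_deriv (by ring)) t ht
  have h2 := hconst (fun t => k * u t * Real.sin (k * t) + p t * Real.cos (k * t)) (fun t ht =>
    ((((hu t ht).const_mul k).mul (hs t).hasDerivWithinAt).add
      ((hp t ht).mul (hc t).hasDerivWithinAt)).congr_deriv (by ring)) t ht
  simp only [mul_zero, Real.cos_zero, Real.sin_zero, mul_one, sub_zero, zero_add] at h1 h2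
  have h3 := Real.sin_sq_add_cos_sq (k * t)
  constructor
  · rw [← h2, show u 0 = (k * u 0) / k by field_simp, ← h1]
    field_simp
    linear_combination (-u t * k) * h3
  · rw [← h2, ← h1]
    linear_combination (-p t) * h3

/-- A function with `-u'' = k² u` in `H²` is a classical solution. -/
theorem IsH2.eqOn_trig {k ℓ : ℝ} (hk : 0 < k) (hℓ : 0 < ℓ) {u p q : ℝ → ℝ} (h : IsH2 ℓ u p q)
    (hq : ∀ᵐ t ∂(volume.restrict (Set.Icc 0 ℓ)), -(q t) = k ^ 2 * u t) :
    ∀ t ∈ Set.Icc 0 ℓ, u t = u 0 * Real.cos (k * t) + p 0 * (Real.sin (k * t) / k) ∧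
      p t = -(k * u 0 * Real.sin (k * t)) + p 0 * Real.cos (k * t) := by
  have hqi : IntegrableOn q (Set.Icc 0 ℓ) := h.memLp.integrable (by norm_num)
  have hderiv : ∀ {U P : ℝ → ℝ}, ContinuousOn P (Set.Icc 0 ℓ) →
      (∀ t ∈ Set.Icc 0 ℓ, U t = U 0 + ∫ s in (0 : ℝ)..t, P s) →
      ∀ t ∈ Set.Icc 0 ℓ, HasDerivWithinAt U (P t) (Set.Icc 0 ℓ) t := by
    intro U P hP hU t ht
    have : Fact (t ∈ Set.Icc 0 ℓ) := ⟨ht⟩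
    have := intervalIntegral.integral_hasDerivWithinAt_right (a := 0) (b := t) (f := P)
      (s := Set.Icc 0 ℓ) (t := Set.Icc 0 ℓ)
      ((hP.mono (Set.Icc_subset_Icc_right ht.2)).intervalIntegrable_of_Icc ht.1)
      (hP.stronglyMeasurableAtFilter_nhdsWithin measurableSet_Icc t) (hP t ht)
    exact (this.const_add (U 0)).congr (fun s hs => hU s hs) (hU t ht)
  have hcont : ∀ {U P : ℝ → ℝ}, IntegrableOn P (Set.Icc 0 ℓ) →
      (∀ t ∈ Set.Icc 0 ℓ, U t = U 0 + ∫ s in (0 : ℝ)..t, P s) →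
      ContinuousOn U (Set.Icc 0 ℓ) := by
    intro U P hP hU
    have := intervalIntegral.continuousOn_primitive_interval (f := P) (a := 0) (b := ℓ)
      (by rwa [Set.uIcc_of_le hℓ.le])
    rw [Set.uIcc_of_le hℓ.le] at this
    exact (continuousOn_const.add this).congr hU
  have hpc : ContinuousOn p (Set.Icc 0 ℓ) := hcont hqi h.integral_q
  have hud := hderiv hpc h.integral_p
  have huc : ContinuousOn u (Set.Icc 0 ℓ) := fun t ht => (hud t ht).continuousWithinAt
  refine eqOn_trig_of_deriv hk hℓ hud (hderiv (by fun_prop) fun t ht => ?_)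
  rw [h.integral_q t ht, add_right_inj]
  refine intervalIntegral.integral_congr_ae ?_
  rw [Set.uIoc_of_le ht.1]
  have hsub : Set.Ioc 0 t ⊆ Set.Icc 0 ℓ :=
    Set.Ioc_subset_Icc_self.trans (Set.Icc_subset_Icc_right ht.2)
  filter_upwards [(ae_restrict_iff' measurableSet_Icc).1 hq] with s hs hst
  rw [← hs (hsub hst), neg_neg]

/-- An eigenfunction to a positive eigenvalue is a classical solution, and its edge functions
extend to all of `ℝ` as trigonometric functions. -/
theorem IsEigenfunction.exists_solves {μ : ℝ} (hμ : 0 < μ) {f : Γ.Point → ℝ}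
    (hf : Γ.IsEigenfunction μ f) :
    ∃ u p, Γ.Solves μ (fun _ _ => 0) (fun v => f (.vertex v)) u p ∧
      (∀ e, ∀ t ∈ Set.Icc 0 (Γ.len e), f (Point.onEdge e t) = u e t) ∧
      ∃ e, ∃ t ∈ Set.Icc 0 (Γ.len e), u e t ≠ 0 := by
  obtain ⟨⟨p, q, hH, hK, hq⟩, hne⟩ := hf
  set k := √μ with hk
  have hk0 : 0 < k := Real.sqrt_pos.2 hμ
  have hkμ : k ^ 2 = μ := Real.sq_sqrt hμ.le
  have htrig := fun e => (hH e).eqOn_trig hk0 (Γ.len_pos e) (by rw [hkμ]; exact hq e)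
  have h1 : ∀ e, Γ.len e ∈ Set.Icc 0 (Γ.len e) := fun e => Set.right_mem_Icc.2 (Γ.len_pos e).le
  set a : E → ℝ := fun e => f (Point.onEdge e 0) with ha
  refine ⟨fun e t => a e * Real.cos (k * t) + p e 0 * (Real.sin (k * t) / k),
    fun e t => -(k * a e * Real.sin (k * t)) + p e 0 * Real.cos (k * t),
    ⟨⟨fun e t => ?_, fun e => by fun_prop, fun e => ?_, fun e => ?_⟩, fun e t => ?_, fun v => ?_⟩,
    fun e t ht => (htrig e t ht).1, ?_⟩
  · exact (((hasDerivAt_cos_const_mul k t).const_mul (a e)).add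
      (((hasDerivAt_sin_const_mul k t).div_const k).const_mul (p e 0))).congr_deriv
        (by field_simp)
  · simp [ha, Point.onEdge_zero]
  · rw [← (htrig e _ (h1 e)).1, Point.onEdge_len]
  · refine ((((hasDerivAt_sin_const_mul k t).const_mul (k * a e)).neg).add
      ((hasDerivAt_cos_const_mul k t).const_mul (p e 0))).congr_deriv ?_
    rw [← hkμ]; field_simp; ring
  · refine Eq.trans ?_ (hK v)
    congr 1
    · simp
    · exact Finset.sum_congr rfl fun e _ => by rw [(htrig e _ (h1 e)).2]
  · by_contra! hz
    refine hne fun e => (ae_restrict_iff' measurableSet_Icc).2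
      (Filter.Eventually.of_forall fun t ht => ?_)
    exact (htrig e t ht).1.trans (hz e t ht)

end

section

variable {V E : Type*} {Γ : MetricGraph V E} [Fintype E]

/-! ### The Fredholm alternative -/

variable (Γ) in
/-- The family of solutions of `u'' = -k² u` on the edges, with value `x.1 (src e)` and derivative
`x.2 e` at the initial end of the edge `e`. -/
noncomputable def trigFamily (k : ℝ) (x : (V → ℝ) × (E → ℝ)) (e : E) (t : ℝ) : ℝ :=
  x.1 (Γ.src e) * Real.cos (k * t) + x.2 e * (Real.sin (k * t) / k)

variable (Γ) in
/-- The derivative of `trigFamily`. -/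
noncomputable def trigFamilyDeriv (k : ℝ) (x : (V → ℝ) × (E → ℝ)) (e : E) (t : ℝ) : ℝ :=
  -(k * x.1 (Γ.src e) * Real.sin (k * t)) + x.2 e * Real.cos (k * t)

omit [Fintype E] in
theorem hasDerivAt_trigFamily {k : ℝ} (hk : k ≠ 0) (x : (V → ℝ) × (E → ℝ)) (e : E) (t : ℝ) :
    HasDerivAt (Γ.trigFamily k x e) (Γ.trigFamilyDeriv k x e t) t :=
  (((hasDerivAt_cos_const_mul k t).const_mul (x.1 (Γ.src e))).add
    (((hasDerivAt_sin_const_mul k t).div_const k).const_mul (x.2 e))).congr_deriv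
      (by unfold trigFamilyDeriv; field_simp)

omit [Fintype E] in
theorem hasDerivAt_trigFamilyDeriv {k : ℝ} (hk : k ≠ 0) (x : (V → ℝ) × (E → ℝ)) (e : E) (t : ℝ) :
    HasDerivAt (Γ.trigFamilyDeriv k x e) (-(k ^ 2 * Γ.trigFamily k x e t)) t :=
  ((((hasDerivAt_sin_const_mul k t).const_mul (k * x.1 (Γ.src e))).neg).add
    ((hasDerivAt_cos_const_mul k t).const_mul (x.2 e))).congr_deriv
      (by unfold trigFamily; field_simp; ring)

open Classical in
variable (Γ) in
/-- The defects of `trigFamily` in the vertex conditions, as a linear map in the initial data: the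
sum of the outgoing derivatives at each vertex, and the jump at the terminal end of each edge. -/
noncomputable def vertexDefect (k : ℝ) : (V → ℝ) × (E → ℝ) →ₗ[ℝ] (V → ℝ) × (E → ℝ) where
  toFun x := (fun v => (∑ e with Γ.src e = v, Γ.trigFamilyDeriv k x e 0) +
      ∑ e with Γ.tgt e = v, -Γ.trigFamilyDeriv k x e (Γ.len e),
    fun e => Γ.trigFamily k x e (Γ.len e) - x.1 (Γ.tgt e))
  map_add' x y := by
    have h : ∀ e t, Γ.trigFamilyDeriv k (x + y) e t
        = Γ.trigFamilyDeriv k x e t + Γ.trigFamilyDeriv k y e t := fun e t => by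
      simp only [trigFamilyDeriv, Prod.fst_add, Prod.snd_add, Pi.add_apply]; ring
    ext i
    · simp only [h, neg_add, Finset.sum_add_distrib, Prod.fst_add, Pi.add_apply]; ring
    · simp only [trigFamily, Prod.fst_add, Prod.snd_add, Pi.add_apply]; ring
  map_smul' c x := by
    have h : ∀ e t, Γ.trigFamilyDeriv k (c • x) e t = c * Γ.trigFamilyDeriv k x e t := fun e t => by
      simp only [trigFamilyDeriv, Prod.smul_fst, Prod.smul_snd, Pi.smul_apply, smul_eq_mul]; ring
    ext i
    · simp only [h, ← mul_neg, ← Finset.mul_sum, Prod.smul_fst, Pi.smul_apply, smul_eq_mul,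
        RingHom.id_apply]; ring
    · simp only [trigFamily, Prod.smul_fst, Prod.smul_snd, Pi.smul_apply, smul_eq_mul,
        RingHom.id_apply]; ring

/-- A family without defects is a solution of the homogeneous problem, hence zero on the edges. The
vertex values are then zero too, since no vertex is isolated. -/
theorem vertexDefect_injective {k : ℝ} (hk : 0 < k)
    (hno : ¬ ∃ f, Γ.IsEigenfunction (k ^ 2) f) (hinc : ∀ v, ∃ e, Γ.src e = v ∨ Γ.tgt e = v) :
    Function.Injective (Γ.vertexDefect k) := by
  classical
  rw [injective_iff_map_eq_zero]
  intro x hx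
  have hsrc : ∀ e, Γ.trigFamily k x e 0 = x.1 (Γ.src e) := fun e => by simp [trigFamily]
  have htgt : ∀ e, Γ.trigFamily k x e (Γ.len e) = x.1 (Γ.tgt e) := fun e =>
    sub_eq_zero.1 (congrFun (congrArg Prod.snd hx) e)
  have hsol : Γ.Solves (k ^ 2) (fun _ _ => 0) x.1 (Γ.trigFamily k x) (Γ.trigFamilyDeriv k x) :=
    { hasDeriv := hasDerivAt_trigFamily hk.ne' x
      cont := fun e => continuous_iff_continuousAt.2 fun t =>
        (hasDerivAt_trigFamilyDeriv hk.ne' x e t).continuousAt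
      src := hsrc
      tgt := htgt
      hasDeriv_p := fun e t => (hasDerivAt_trigFamilyDeriv hk.ne' x e t).congr_deriv
        (sub_zero _).symm
      kirchhoff := fun v => congrFun (congrArg Prod.fst hx) v }
  have h0 : ∀ e, (0 : ℝ) ∈ Set.Icc 0 (Γ.len e) := fun e => Set.left_mem_Icc.2 (Γ.len_pos e).le
  have hz := fun e t ht => hsol.eq_zero_of_not_isEigenfunction hno e (t := t) ht
  ext i
  · obtain ⟨e, rfl | rfl⟩ := hinc i
    · exact (hsrc e).symm.trans (hz e 0 (h0 e))
    · exact (htgt e).symm.trans (hz e _ (Set.right_mem_Icc.2 (Γ.len_pos e).le))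
  · have h1 : HasDerivWithinAt (Γ.trigFamily k x i) 0 (Set.Icc 0 (Γ.len i)) 0 :=
      (hasDerivWithinAt_const (0 : ℝ) _ (0 : ℝ)).congr (fun t ht => hz i t ht) (hz i 0 (h0 i))
    have h2 := (uniqueDiffOn_Icc (Γ.len_pos i) 0 (h0 i)).eq_deriv _ h1
      (hasDerivAt_trigFamily hk.ne' x i 0).hasDerivWithinAt
    simpa [trigFamilyDeriv] using h2.symm

/-- If `ν > 0` is not an eigenvalue then `-w'' = ν w + g` is solvable for all continuous `g`, with a
bound on the solution operator. The edgewise solution with zero initial data (Duhamel's formula) is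
corrected by a trigonometric function, found by inverting `vertexDefect`. -/
theorem exists_solves_of_not_isEigenfunction [Fintype V] {ν : ℝ} (hν : 0 < ν)
    (hno : ¬ ∃ f, Γ.IsEigenfunction ν f) (hinc : ∀ v, ∃ e, Γ.src e = v ∨ Γ.tgt e = v) :
    ∃ C : ℝ, 0 < C ∧ ∀ g : E → ℝ → ℝ, (∀ e, Continuous (g e)) → ∃ φ w p, Γ.Solves ν g φ w p ∧
      Γ.total (fun e t => g e t * w e t) ≤ C * Γ.total (fun e t => g e t ^ 2) := by
  classical
  obtain ⟨k, hk, rfl⟩ : ∃ k : ℝ, 0 < k ∧ k ^ 2 = ν := ⟨√ν, Real.sqrt_pos.2 hν, Real.sq_sqrt hν.le⟩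
  set R := LinearEquiv.ofInjectiveEndo (Γ.vertexDefect k) (vertexDefect_injective hk hno hinc)
  obtain ⟨M, hM0, hM⟩ : ∃ M : ℝ, 0 < M ∧ ∀ y, ‖R.symm y‖ ≤ M * ‖y‖ :=
    (LinearMap.toContinuousLinearMap R.symm.toLinearMap).bound
  set n : ℝ := (Fintype.card E : ℝ) with hn
  have hn0 : 0 ≤ n := Nat.cast_nonneg _
  -- `D` times the `L¹` norm of `g` will be a uniform bound for the solution
  set D : ℝ := (1 + 1 / k) * (M * (2 * n + 2 / k)) + 2 / k with hD
  have hL0 : 0 ≤ ∑ e, Γ.len e := Finset.sum_nonneg fun e _ => (Γ.len_pos e).le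
  refine ⟨D * (∑ e, Γ.len e) + 1, by positivity, fun g hg => ?_⟩
  set N := Γ.total (fun e t => |g e t|) with hN
  have hN0 : 0 ≤ N := total_nonneg fun e t _ => abs_nonneg _
  let c : E → ℝ → ℝ := fun e t => ∫ s in (0 : ℝ)..t, Real.cos (k * s) * g e s
  let s : E → ℝ → ℝ := fun e t => ∫ s in (0 : ℝ)..t, Real.sin (k * s) * g e s
  have hc' : ∀ e t, HasDerivAt (c e) (Real.cos (k * t) * g e t) t := fun e t =>
    (show Continuous fun s => Real.cos (k * s) * g e s by fun_prop).integral_hasStrictDerivAt 0 t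
      |>.hasDerivAt
  have hs' : ∀ e t, HasDerivAt (s e) (Real.sin (k * t) * g e t) t := fun e t =>
    (show Continuous fun s => Real.sin (k * s) * g e s by fun_prop).integral_hasStrictDerivAt 0 t
      |>.hasDerivAt
  have hcb : ∀ e, ∀ t ∈ Set.Icc 0 (Γ.len e), |c e t| ≤ N := fun e t ht =>
    abs_integral_le_total (h := fun e s => Real.cos (k * s) * g e s) hg (by fun_prop)
      (fun e t => by
        rw [abs_mul]
        exact mul_le_of_le_one_left (abs_nonneg _) (Real.abs_cos_le_one _)) e ht
  have hsb : ∀ e, ∀ t ∈ Set.Icc 0 (Γ.len e), |s e t| ≤ N := fun e t ht =>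
    abs_integral_le_total (h := fun e s => Real.sin (k * s) * g e s) hg (by fun_prop)
      (fun e t => by
        rw [abs_mul]
        exact mul_le_of_le_one_left (abs_nonneg _) (Real.abs_sin_le_one _)) e ht
  have hrot : ∀ θ a b : ℝ, |a| ≤ N → |b| ≤ N →
      |Real.sin θ * a - Real.cos θ * b| ≤ 2 * N ∧ |Real.cos θ * a + Real.sin θ * b| ≤ 2 * N := by
    intro θ a b ha hb
    have h1 : |Real.sin θ * a| ≤ N := by
      rw [abs_mul]; exact (mul_le_of_le_one_left (abs_nonneg _) (Real.abs_sin_le_one _)).trans ha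
    have h2 : |Real.cos θ * b| ≤ N := by
      rw [abs_mul]; exact (mul_le_of_le_one_left (abs_nonneg _) (Real.abs_cos_le_one _)).trans hb
    have h3 : |Real.cos θ * a| ≤ N := by
      rw [abs_mul]; exact (mul_le_of_le_one_left (abs_nonneg _) (Real.abs_cos_le_one _)).trans ha
    have h4 : |Real.sin θ * b| ≤ N := by
      rw [abs_mul]; exact (mul_le_of_le_one_left (abs_nonneg _) (Real.abs_sin_le_one _)).trans hb
    exact ⟨(abs_sub _ _).trans (by linarith), (abs_add_le _ _).trans (by linarith)⟩
  -- Duhamel's formula for the solution with zero initial data, and its derivative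
  let W : E → ℝ → ℝ := fun e t => -(1 / k) * (Real.sin (k * t) * c e t - Real.cos (k * t) * s e t)
  let P : E → ℝ → ℝ := fun e t => -(Real.cos (k * t) * c e t + Real.sin (k * t) * s e t)
  have hW' : ∀ e t, HasDerivAt (W e) (P e t) t := fun e t =>
    ((((hasDerivAt_sin_const_mul k t).mul (hc' e t)).sub
      ((hasDerivAt_cos_const_mul k t).mul (hs' e t))).const_mul (-(1 / k))).congr_deriv
        (by simp only [P]; field_simp; ring)
  have hP' : ∀ e t, HasDerivAt (P e) (-(k ^ 2 * W e t) - g e t) t := fun e t =>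
    ((((hasDerivAt_cos_const_mul k t).mul (hc' e t)).add
      ((hasDerivAt_sin_const_mul k t).mul (hs' e t))).neg).congr_deriv (by
        have := Real.sin_sq_add_cos_sq (k * t)
        simp only [W]; field_simp; linear_combination (-g e t) * this)
  have hWb : ∀ e, ∀ t ∈ Set.Icc 0 (Γ.len e), |W e t| ≤ 2 / k * N := fun e t ht => by
    have := (hrot (k * t) _ _ (hcb e t ht) (hsb e t ht)).1
    simp only [W]
    rw [abs_mul, abs_neg, abs_of_pos (by positivity : 0 < 1 / k)]
    calc 1 / k * _ ≤ 1 / k * (2 * N) := by gcongr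
      _ = 2 / k * N := by ring
  have hPb : ∀ e, ∀ t ∈ Set.Icc 0 (Γ.len e), |P e t| ≤ 2 * N := fun e t ht => by
    simp only [P]
    rw [abs_neg]
    exact (hrot (k * t) _ _ (hcb e t ht) (hsb e t ht)).2
  have hW0 : ∀ e, W e 0 = 0 := fun e => by simp [W, s]
  have hP0 : ∀ e, P e 0 = 0 := fun e => by simp [P, c]
  have hr : ∀ e, Γ.len e ∈ Set.Icc 0 (Γ.len e) := fun e => Set.right_mem_Icc.2 (Γ.len_pos e).le
  let y : (V → ℝ) × (E → ℝ) :=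
    (fun v => ∑ e with Γ.tgt e = v, P e (Γ.len e), fun e => -W e (Γ.len e))
  have hyb : ‖y‖ ≤ (2 * n + 2 / k) * N := by
    refine max_le ((pi_norm_le_iff_of_nonneg (by positivity)).2 fun v => ?_)
      ((pi_norm_le_iff_of_nonneg (by positivity)).2 fun e => ?_)
    · calc ‖∑ e with Γ.tgt e = v, P e (Γ.len e)‖ ≤ ∑ e with Γ.tgt e = v, ‖P e (Γ.len e)‖ :=
            norm_sum_le _ _
        _ ≤ ∑ e, ‖P e (Γ.len e)‖ := Finset.sum_le_sum_of_subset_of_nonneg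
            (Finset.filter_subset _ _) fun _ _ _ => norm_nonneg _
        _ ≤ ∑ _e : E, 2 * N := Finset.sum_le_sum fun e _ => hPb e _ (hr e)
        _ = 2 * n * N := by simp [hn]; ring
        _ ≤ (2 * n + 2 / k) * N := by gcongr; linarith [show 0 < 2 / k by positivity]
    · rw [norm_neg]
      refine (hWb e _ (hr e)).trans ?_
      gcongr; linarith
  set x := R.symm y with hx
  have hxy : Γ.vertexDefect k x = y := R.apply_symm_apply y
  have hxb : ‖x‖ ≤ M * (2 * n + 2 / k) * N :=
    (hM y).trans (by rw [mul_assoc]; gcongr)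
  have hwb : ∀ e, ∀ t ∈ Set.Icc 0 (Γ.len e), |Γ.trigFamily k x e t + W e t| ≤ D * N := by
    intro e t ht
    have h1 : |x.1 (Γ.src e)| ≤ ‖x‖ := (norm_le_pi_norm x.1 _).trans (norm_fst_le x)
    have h2 : |x.2 e| ≤ ‖x‖ := (norm_le_pi_norm x.2 _).trans (norm_snd_le x)
    have h3 : |Γ.trigFamily k x e t| ≤ (1 + 1 / k) * ‖x‖ := by
      unfold trigFamily
      calc _ ≤ |x.1 (Γ.src e)| * |Real.cos (k * t)| + |x.2 e| * (|Real.sin (k * t)| / k) := by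
            rw [← abs_mul]
            refine (abs_add_le _ _).trans_eq ?_
            rw [abs_mul (x.2 e), abs_div, abs_of_pos hk]
        _ ≤ ‖x‖ * 1 + ‖x‖ * (1 / k) := by
            gcongr
            exacts [Real.abs_cos_le_one _, Real.abs_sin_le_one _]
        _ = (1 + 1 / k) * ‖x‖ := by ring
    calc _ ≤ |Γ.trigFamily k x e t| + |W e t| := abs_add_le _ _
      _ ≤ (1 + 1 / k) * (M * (2 * n + 2 / k) * N) + 2 / k * N :=
          add_le_add (h3.trans (by gcongr)) (hWb e t ht)
      _ = D * N := by rw [hD]; ring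
  have hsol : Γ.Solves (k ^ 2) g x.1 (fun e t => Γ.trigFamily k x e t + W e t)
      (fun e t => Γ.trigFamilyDeriv k x e t + P e t) :=
    { hasDeriv := fun e t => (hasDerivAt_trigFamily hk.ne' x e t).add (hW' e t)
      cont := fun e => continuous_iff_continuousAt.2 fun t =>
        ((hasDerivAt_trigFamilyDeriv hk.ne' x e t).add (hP' e t)).continuousAt
      src := fun e => by rw [hW0]; simp [trigFamily]
      tgt := fun e => by
        have h : Γ.trigFamily k x e (Γ.len e) - x.1 (Γ.tgt e) = -W e (Γ.len e) :=
          congrFun (congrArg Prod.snd hxy) e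
        linarith
      hasDeriv_p := fun e t => ((hasDerivAt_trigFamilyDeriv hk.ne' x e t).add
        (hP' e t)).congr_deriv (by ring)
      kirchhoff := fun v => by
        have h : (∑ e with Γ.src e = v, Γ.trigFamilyDeriv k x e 0) +
            (∑ e with Γ.tgt e = v, -Γ.trigFamilyDeriv k x e (Γ.len e)) =
            ∑ e with Γ.tgt e = v, P e (Γ.len e) :=
          congrFun (congrArg Prod.fst hxy) v
        simp only [hP0, add_zero, neg_add, Finset.sum_add_distrib]
        rw [← add_assoc]
        refine Eq.trans (congrArg (· + _) ?_) (by
          rw [Finset.sum_neg_distrib]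
          exact add_neg_cancel (∑ e with Γ.tgt e = v, P e (Γ.len e)))
        convert h }
  refine ⟨_, _, _, hsol, ?_⟩
  have cw := hsol.toIsC1.continuous
  calc _ ≤ Γ.total (fun e t => D * N * |g e t|) := by
        refine total_mono (fun e => (hg e).mul (cw e)) (by fun_prop) fun e t ht => ?_
        refine (le_abs_self _).trans ?_
        rw [abs_mul, mul_comm]
        exact mul_le_mul_of_nonneg_right (hwb e t ht) (abs_nonneg _)
    _ = D * N ^ 2 := by rw [total_const_mul, ← hN]; ring
    _ ≤ D * ((∑ e, Γ.len e) * Γ.total (fun e t => g e t ^ 2)) := by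
        gcongr; exact sq_total_abs_le hg
    _ ≤ _ := by
        have : 0 ≤ Γ.total (fun e t => g e t ^ 2) := total_nonneg fun e t _ => sq_nonneg _
        linarith

end

section

variable {V E : Type*} {Γ : MetricGraph V E} [Fintype E]

/-! ### The variational principle -/

/-- A trial function of mean zero whose Rayleigh quotient is less than `μ` gives an eigenvalue in
`(0, μ)`. The eigenvalue is the infimum `R` of the Rayleigh quotients: were it not an eigenvalue,
testing the inequality for `R` with `u - s w`, where `w` solves `-w'' = R w + u`, would improve it
to `R + s` for a small `s > 0`. -/
theorem exists_isEigenfunction_lt [Fintype V] (hconn : Γ.toSimpleGraph.Connected)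
    (hinc : ∀ v, ∃ e, Γ.src e = v ∨ Γ.tgt e = v) {μ : ℝ} (hμ : 0 < μ) {φ : V → ℝ}
    {u p : E → ℝ → ℝ} (hu : Γ.IsC1 φ u p) (hu0 : Γ.total u = 0)
    (hlt : Γ.total (fun e t => p e t ^ 2) < μ * Γ.total (fun e t => u e t ^ 2)) :
    ∃ ν, 0 < ν ∧ ν < μ ∧ ∃ f, Γ.IsEigenfunction ν f := by
  set S : Set ℝ := {ν | ∀ φ u p, Γ.IsC1 φ u p → Γ.total u = 0 →
    ν * Γ.total (fun e t => u e t ^ 2) ≤ Γ.total (fun e t => p e t ^ 2)} with hS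
  obtain ⟨C, hC, hpoin⟩ := exists_poincare hconn
  have hCS : 1 / C ∈ S := fun φ u p hu h0 => by
    rw [one_div, inv_mul_le_iff₀ hC]
    exact hpoin φ u p hu h0
  have hp0 : 0 ≤ Γ.total (fun e t => p e t ^ 2) := total_nonneg fun e t _ => sq_nonneg _
  have hU : 0 < Γ.total (fun e t => u e t ^ 2) := pos_of_mul_pos_right (hp0.trans_lt hlt) hμ.le
  have hbdd : Γ.total (fun e t => p e t ^ 2) / Γ.total (fun e t => u e t ^ 2) ∈ upperBounds S :=
    fun ν hν => (le_div_iff₀ hU).2 (hν φ u p hu hu0)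
  set R := sSup S with hR
  have hRpos : 0 < R := (by positivity : 0 < 1 / C).trans_le (le_csSup ⟨_, hbdd⟩ hCS)
  have hRlt : R < μ := (csSup_le ⟨_, hCS⟩ hbdd).trans_lt ((div_lt_iff₀ hU).2 hlt)
  have hRS : R ∈ S := fun φ u p hu h0 => by
    have hp : 0 ≤ Γ.total (fun e t => p e t ^ 2) := total_nonneg fun e t _ => sq_nonneg _
    rcases (show 0 ≤ Γ.total (fun e t => u e t ^ 2) from
      total_nonneg fun e t _ => sq_nonneg _).eq_or_lt with h | h
    · rwa [← h, mul_zero]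
    · exact (le_div_iff₀ h).1 (csSup_le ⟨_, hCS⟩ fun ν hν => (le_div_iff₀ h).2 (hν φ u p hu h0))
  refine ⟨R, hRpos, hRlt, ?_⟩
  by_contra hno
  obtain ⟨D, hD, hsolve⟩ := exists_solves_of_not_isEigenfunction hRpos hno hinc
  have hmem : R + 1 / D ∈ S := by
    intro φ u p hu hu0
    have cu := hu.continuous
    have cp := hu.cont
    obtain ⟨ψ, w, q, hw, hwb⟩ := hsolve u cu
    have cw := hw.toIsC1.continuous
    have cq := hw.cont
    have hw0 : Γ.total w = 0 := by
      have := hw.weak_form cu (isC1_const (Γ := Γ) 1)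
      simp only [mul_zero, mul_one] at this
      have h0 : Γ.total (fun _ _ => 0) = 0 := by simp [total]
      rw [h0, hu0, add_zero] at this
      exact (mul_eq_zero.1 this.symm).resolve_left hRpos.ne'
    have hz := hw.toIsC1
    have h1 := hRS _ _ _ (hu.add_smul hz (-(1 / D)))
      (by rw [total_add cu (by fun_prop), total_const_mul, hu0, hw0]; simp)
    have hexp : ∀ a b : E → ℝ → ℝ, (∀ e, Continuous (a e)) → (∀ e, Continuous (b e)) →
        Γ.total (fun e t => (a e t + -(1 / D) * b e t) ^ 2)
          = Γ.total (fun e t => a e t ^ 2) + (-(2 / D)) * Γ.total (fun e t => b e t * a e t)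
            + (1 / D) ^ 2 * Γ.total (fun e t => b e t * b e t) := by
      intro a b ha hb
      rw [← total_const_mul, ← total_const_mul, ← total_add (by fun_prop) (by fun_prop),
        ← total_add (by fun_prop) (by fun_prop)]
      exact total_congr fun e t => by ring
    rw [hexp u w cu cw, hexp p q cp cq, hw.weak_form cu hu, hw.weak_form cu hw.toIsC1] at h1
    have h2 : Γ.total (fun e t => u e t * u e t) = Γ.total (fun e t => u e t ^ 2) :=
      total_congr fun e t => by ring
    rw [h2] at h1
    have h3 : (1 / D) ^ 2 * Γ.total (fun e t => u e t * w e t)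
        ≤ 1 / D * Γ.total (fun e t => u e t ^ 2) := by
      refine (mul_le_mul_of_nonneg_left hwb (by positivity)).trans_eq ?_
      field_simp
    have h4 : 2 / D = 2 * (1 / D) := by ring
    rw [h4] at h1
    linarith
  have := le_csSup ⟨_, hbdd⟩ hmem
  have : 0 < 1 / D := by positivity
  linarith

end

section

variable {V E : Type*} {Γ : MetricGraph V E}

/-! ### Cutting a tree -/

/-- Removing an edge from a tree leaves two sides, which no other edge joins. -/
theorem IsTree.exists_cut (hΓ : Γ.IsTree) (e₀ : E) :
    ∃ A : Set V, Γ.src e₀ ∈ A ∧ Γ.tgt e₀ ∉ A ∧ ∀ e, e ≠ e₀ → (Γ.src e ∈ A ↔ Γ.tgt e ∈ A) := by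
  set G := Γ.toSimpleGraph.deleteEdges {s(Γ.src e₀, Γ.tgt e₀)} with hG
  have hadj : ∀ e, Γ.toSimpleGraph.Adj (Γ.src e) (Γ.tgt e) := fun e => by
    rw [toSimpleGraph, SimpleGraph.fromRel_adj]
    exact ⟨hΓ.no_loops e, Or.inl ⟨e, rfl, rfl⟩⟩
  have hbr : Γ.toSimpleGraph.IsBridge s(Γ.src e₀, Γ.tgt e₀) :=
    SimpleGraph.isAcyclic_iff_forall_adj_isBridge.1 hΓ.isTree.isAcyclic (hadj e₀)
  rw [SimpleGraph.isBridge_iff] at hbr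
  refine ⟨{v | G.Reachable (Γ.src e₀) v}, SimpleGraph.Reachable.refl _, ?_, fun e he => ?_⟩
  · exact hbr
  · have h : G.Adj (Γ.src e) (Γ.tgt e) := by
      rw [hG, SimpleGraph.deleteEdges_adj]
      exact ⟨hadj e, fun h => he (hΓ.no_parallel h)⟩
    exact ⟨fun h' => h'.trans h.reachable, fun h' => h'.trans h.symm.reachable⟩

theorem exists_incident (hconn : Γ.toSimpleGraph.Connected) (e₀ : E) (v : V) :
    ∃ e, Γ.src e = v ∨ Γ.tgt e = v := by
  obtain ⟨W⟩ := hconn.preconnected v (Γ.src e₀)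
  cases W with
  | nil => exact ⟨e₀, Or.inl rfl⟩
  | cons h _ =>
    obtain ⟨e, he⟩ := exists_edge_of_adj h
    exact ⟨e, he.imp And.left And.right⟩

/-! ### The trial function -/

theorem hasDerivAt_ite_le {g g' : ℝ → ℝ} (h : ∀ t, HasDerivAt g (g' t) t) {a : ℝ} (ha : g a = 0)
    (ha' : g' a = 0) (t : ℝ) :
    HasDerivAt (fun t => if t ≤ a then g t else 0) (if t ≤ a then g' t else 0) t := by
  rcases lt_trichotomy t a with hlt | rfl | hgt
  · rw [if_pos hlt.le]
    refine (h t).congr_of_eventuallyEq ?_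
    filter_upwards [Iio_mem_nhds hlt] with s hs using if_pos (le_of_lt hs)
  · rw [if_pos le_rfl, ha', ← hasDerivWithinAt_univ, ← Set.Iic_union_Ici (a := t)]
    refine HasDerivWithinAt.union ?_ ?_
    · refine (ha' ▸ (h t).hasDerivWithinAt).congr (fun s hs => if_pos hs) (if_pos le_rfl)
    · refine (hasDerivWithinAt_const t _ (0 : ℝ)).congr (fun s hs => ?_) (by simp [ha])
      rcases eq_or_lt_of_le (Set.mem_Ici.1 hs) with rfl | hs
      · simp [ha]
      · exact if_neg (not_le.2 hs)
  · rw [if_neg (not_le.2 hgt)]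
    refine (hasDerivAt_const t (0 : ℝ)).congr_of_eventuallyEq ?_
    filter_upwards [Ioi_mem_nhds hgt] with s hs using if_neg (not_le.2 hs)

open Classical in
/-- The family `g`, restricted to one side of the point with coordinate `a` on the edge `e₀` and
extended by zero. This side consists of the part `t ≤ a` of `e₀` and of the other edges with initial
vertex in `A`. -/
noncomputable def cutOff (A : Set V) (e₀ : E) (a : ℝ) (src : E → V) (g : E → ℝ → ℝ) (e : E)
    (t : ℝ) : ℝ :=
  if e = e₀ then (if t ≤ a then g e t else 0) else if src e ∈ A then g e t else 0

open Classical in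
/-- Cutting off at a point where the function vanishes to first order leaves it `C¹`. -/
theorem IsC1.cutOff {φ : V → ℝ} {u p : E → ℝ → ℝ} (h : Γ.IsC1 φ u p) {A : Set V} {e₀ : E}
    (hsrc : Γ.src e₀ ∈ A) (htgt : Γ.tgt e₀ ∉ A)
    (hA : ∀ e, e ≠ e₀ → (Γ.src e ∈ A ↔ Γ.tgt e ∈ A)) {a : ℝ} (ha : a ∈ Set.Icc 0 (Γ.len e₀))
    (hu : u e₀ a = 0) (hp : p e₀ a = 0) :
    Γ.IsC1 (fun v => if v ∈ A then φ v else 0) (cutOff A e₀ a Γ.src u)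
      (cutOff A e₀ a Γ.src p) where
  hasDeriv e t := by
    unfold MetricGraph.cutOff
    by_cases he : e = e₀
    · subst he
      simpa using hasDerivAt_ite_le (h.hasDeriv e) hu hp t
    · by_cases hs : Γ.src e ∈ A
      · simpa [he, hs] using h.hasDeriv e t
      · simpa [he, hs] using hasDerivAt_const t (0 : ℝ)
  cont e := by
    unfold MetricGraph.cutOff
    by_cases he : e = e₀
    · subst he
      simpa using Continuous.if_le (h.cont e) continuous_const continuous_id continuous_const
        (fun t ht => by rw [show t = a from ht, hp])
    · by_cases hs : Γ.src e ∈ A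
      · simpa [he, hs] using h.cont e
      · simpa [he, hs] using continuous_const
  src e := by
    unfold MetricGraph.cutOff
    by_cases he : e = e₀
    · subst he
      simp [hsrc, ha.1, h.src]
    · simp [he, h.src]
  tgt e := by
    unfold MetricGraph.cutOff
    by_cases he : e = e₀
    · subst he
      -- if `len e ≤ a` then the cut is at the end vertex, where `u` vanishes
      by_cases hl : Γ.len e ≤ a
      · rw [le_antisymm ha.2 hl] at hu
        simp [htgt, hu]
      · simp [htgt, hl]
    · simp [he, hA e he, h.tgt]

variable [Fintype E]

theorem total_pos {g : E → ℝ → ℝ} (hg : ∀ e, Continuous (g e))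
    (h0 : ∀ e, ∀ t ∈ Set.Icc 0 (Γ.len e), 0 ≤ g e t)
    (hpos : ∃ e, ∃ t ∈ Set.Icc 0 (Γ.len e), 0 < g e t) : 0 < Γ.total g := by
  obtain ⟨e, he⟩ := hpos
  exact Finset.sum_pos' (fun e _ => intervalIntegral.integral_nonneg (Γ.len_pos e).le (h0 e))
    ⟨e, Finset.mem_univ e, intervalIntegral.integral_pos (Γ.len_pos e) (hg e).continuousOn
      (fun t ht => h0 e t (Set.Ioc_subset_Icc_self ht)) he⟩

theorem Solves.exists_ne {μ : ℝ} (hμ : μ ≠ 0) {φ : V → ℝ} {u p : E → ℝ → ℝ}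
    (h : Γ.Solves μ (fun _ _ => 0) φ u p) {M : ℝ} (hM : M ≠ 0) (e : E) {a b : ℝ} (hab : a < b) :
    ∃ t ∈ Set.Icc a b, u e t ≠ M := by
  by_contra! hc
  have hp : ∀ t ∈ Set.Ioo a b, p e t = 0 := fun t ht => by
    refine (h.hasDeriv e t).unique ((hasDerivAt_const t M).congr_of_eventuallyEq ?_)
    filter_upwards [Ioo_mem_nhds ht.1 ht.2] with s hs using hc s (Set.Ioo_subset_Icc_self hs)
  obtain ⟨t, ht⟩ := Set.nonempty_Ioo.2 hab
  have h1 : -(μ * u e t) - 0 = 0 := by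
    refine (h.hasDeriv_p e t).unique ((hasDerivAt_const t (0 : ℝ)).congr_of_eventuallyEq ?_)
    filter_upwards [Ioo_mem_nhds ht.1 ht.2] with s hs using hp s hs
  rw [hc t (Set.Ioo_subset_Icc_self ht), sub_zero, neg_eq_zero] at h1
  exact (mul_ne_zero hμ hM) h1

theorem Solves.total_eq_zero [Fintype V] {μ : ℝ} (hμ : μ ≠ 0) {φ : V → ℝ} {u p : E → ℝ → ℝ}
    (h : Γ.Solves μ (fun _ _ => 0) φ u p) : Γ.total u = 0 := by
  have := h.weak_form (fun _ => continuous_const) (isC1_const (Γ := Γ) 1)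
  have h0 : Γ.total (fun _ _ => 0) = 0 := by simp [total]
  simp only [mul_zero, mul_one, h0, add_zero] at this
  exact (mul_eq_zero.1 this.symm).resolve_left hμ

theorem Solves.max_pos [Fintype V] {μ : ℝ} (hμ : μ ≠ 0) {φ : V → ℝ} {u p : E → ℝ → ℝ}
    (h : Γ.Solves μ (fun _ _ => 0) φ u p) (hne : ∃ e, ∃ t ∈ Set.Icc 0 (Γ.len e), u e t ≠ 0) {M : ℝ}
    (hM : ∀ e, ∀ t ∈ Set.Icc 0 (Γ.len e), u e t ≤ M) : 0 < M := by
  by_contra! hM0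
  obtain ⟨e, t, ht, hne⟩ := hne
  have cu := h.toIsC1.continuous
  have := total_pos (Γ := Γ) (g := fun e t => (-1) * u e t) (by fun_prop)
    (fun e t ht => by linarith [hM e t ht])
    ⟨e, t, ht, by linarith [lt_of_le_of_ne ((hM e t ht).trans hM0) hne]⟩
  rw [total_const_mul, h.total_eq_zero hμ] at this
  simp at this

/-- A piece `G` of `M - u` that does not overlap with the rest of it satisfies an energy identity:
`∫ G'²` falls short of `μ ∫ G²` by `μ M ∫ G`. -/
theorem Solves.energy_of_piece [Fintype V] {μ : ℝ} {φ ψ : V → ℝ} {u p G P : E → ℝ → ℝ}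
    (h : Γ.Solves μ (fun _ _ => 0) φ u p) (hG : Γ.IsC1 ψ G P) {M : ℝ}
    (hGu : ∀ e t, G e t * G e t = (M - u e t) * G e t)
    (hPp : ∀ e t, P e t * P e t = -p e t * P e t) :
    Γ.total (fun e t => P e t ^ 2) = μ * Γ.total (fun e t => G e t ^ 2) - μ * M * Γ.total G := by
  have cu := h.toIsC1.continuous
  have cG := hG.continuous
  have h1 := h.weak_form (fun _ => continuous_const) hG
  have h0 : Γ.total (fun _ _ => 0) = 0 := by simp [total]
  simp only [zero_mul, h0, add_zero] at h1
  have h2 : Γ.total (fun e t => P e t ^ 2) = -1 * Γ.total (fun e t => p e t * P e t) := by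
    rw [← total_const_mul]
    exact total_congr fun e t => by linear_combination hPp e t
  have h3 : Γ.total (fun e t => G e t ^ 2)
      = M * Γ.total G + -1 * Γ.total (fun e t => u e t * G e t) := by
    rw [← total_const_mul, ← total_const_mul, ← total_add (by fun_prop) (by fun_prop)]
    exact total_congr fun e t => by linear_combination hGu e t
  rw [h2, h1, h3]; ring

/-- If a solution has its maximum `M`, with vanishing derivative, at a point that separates `Γ` into
two nondegenerate sides, then a combination of the restrictions of `M - u` to the sides is a trial
function of mean zero with Rayleigh quotient less than `μ`. -/
theorem Solves.exists_trial [Fintype V] {μ : ℝ} (hμ : 0 < μ) {φ : V → ℝ} {u p : E → ℝ → ℝ}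
    (h : Γ.Solves μ (fun _ _ => 0) φ u p) (hne : ∃ e, ∃ t ∈ Set.Icc 0 (Γ.len e), u e t ≠ 0)
    {A : Set V} {e₀ : E} (hsrc : Γ.src e₀ ∈ A) (htgt : Γ.tgt e₀ ∉ A)
    (hA : ∀ e, e ≠ e₀ → (Γ.src e ∈ A ↔ Γ.tgt e ∈ A)) {a : ℝ} (ha : a ∈ Set.Icc 0 (Γ.len e₀))
    (hmax : ∀ e, ∀ t ∈ Set.Icc 0 (Γ.len e), u e t ≤ u e₀ a) (hp : p e₀ a = 0)
    (h₁ : 0 < a ∨ ∃ e, e ≠ e₀ ∧ Γ.src e ∈ A)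
    (h₂ : a < Γ.len e₀ ∨ ∃ e, e ≠ e₀ ∧ Γ.src e ∉ A) :
    ∃ ψ w q, Γ.IsC1 ψ w q ∧ Γ.total w = 0 ∧
      Γ.total (fun e t => q e t ^ 2) < μ * Γ.total (fun e t => w e t ^ 2) := by
  set M := u e₀ a with hM
  have hM0 : 0 < M := h.max_pos hμ.ne' hne hmax
  have hF := (isC1_const (Γ := Γ) M).add_smul h.toIsC1 (-1)
  have hG₁ := hF.cutOff hsrc htgt hA ha (by simp [hM]) (by simp [hp])
  have hG₂ := hF.add_smul hG₁ (-1)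
  set G₁ := cutOff A e₀ a Γ.src (fun e t => M + -1 * u e t) with hG₁d
  set P₁ := cutOff A e₀ a Γ.src (fun e t => 0 + -1 * p e t) with hP₁d
  set G₂ : E → ℝ → ℝ := fun e t => M + -1 * u e t + -1 * G₁ e t with hG₂d
  set P₂ : E → ℝ → ℝ := fun e t => 0 + -1 * p e t + -1 * P₁ e t with hP₂d
  have hor : ∀ e t, (G₁ e t = M - u e t ∧ P₁ e t = -p e t) ∨ (G₁ e t = 0 ∧ P₁ e t = 0) := by
    intro e t
    simp only [hG₁d, hP₁d, cutOff]
    split_ifs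
    exacts [Or.inl ⟨by ring, by ring⟩, Or.inr ⟨rfl, rfl⟩, Or.inl ⟨by ring, by ring⟩,
      Or.inr ⟨rfl, rfl⟩]
  have hE₁ := h.energy_of_piece hG₁ (M := M)
    (fun e t => by rcases hor e t with ⟨h1, h2⟩ | ⟨h1, h2⟩ <;> simp [h1])
    (fun e t => by rcases hor e t with ⟨h1, h2⟩ | ⟨h1, h2⟩ <;> simp [h2])
  have hE₂ := h.energy_of_piece hG₂ (M := M)
    (fun e t => by rcases hor e t with ⟨h1, h2⟩ | ⟨h1, h2⟩ <;> (simp only [hG₂d, h1]; ring))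
    (fun e t => by rcases hor e t with ⟨h1, h2⟩ | ⟨h1, h2⟩ <;> (simp only [hP₂d, h2]; ring))
  have hI₁ : 0 < Γ.total G₁ := by
    refine total_pos hG₁.continuous (fun e t ht => ?_) ?_
    · rcases hor e t with ⟨h1, -⟩ | ⟨h1, -⟩ <;> rw [h1]
      linarith [hmax e t ht]
    · rcases h₁ with h₁ | ⟨e, he, heA⟩
      · obtain ⟨t, ht, hut⟩ := h.exists_ne hμ.ne' hM0.ne' e₀ h₁
        have ht' : t ∈ Set.Icc 0 (Γ.len e₀) := ⟨ht.1, ht.2.trans ha.2⟩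
        refine ⟨e₀, t, ht', ?_⟩
        simp only [hG₁d, cutOff, if_true, if_pos ht.2]
        linarith [lt_of_le_of_ne (hmax e₀ t ht') hut]
      · obtain ⟨t, ht, hut⟩ := h.exists_ne hμ.ne' hM0.ne' e (Γ.len_pos e)
        refine ⟨e, t, ht, ?_⟩
        simp only [hG₁d, cutOff, if_neg he, if_pos heA]
        linarith [lt_of_le_of_ne (hmax e t ht) hut]
  have hI₂ : 0 < Γ.total G₂ := by
    refine total_pos hG₂.continuous (fun e t ht => ?_) ?_
    · rcases hor e t with ⟨h1, -⟩ | ⟨h1, -⟩ <;> simp only [hG₂d, h1] <;> linarith [hmax e t ht]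
    · rcases h₂ with h₂ | ⟨e, he, heA⟩
      · obtain ⟨t, ht, hut⟩ := h.exists_ne hμ.ne' hM0.ne' e₀ h₂
        have ht' : t ∈ Set.Icc 0 (Γ.len e₀) := ⟨ha.1.trans ht.1, ht.2⟩
        have hat : ¬ t ≤ a := fun hta => hut (by rw [le_antisymm hta ht.1])
        refine ⟨e₀, t, ht', ?_⟩
        simp only [hG₂d, hG₁d, cutOff, if_true, if_neg hat]
        linarith [lt_of_le_of_ne (hmax e₀ t ht') hut]
      · obtain ⟨t, ht, hut⟩ := h.exists_ne hμ.ne' hM0.ne' e (Γ.len_pos e)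
        refine ⟨e, t, ht, ?_⟩
        simp only [hG₂d, hG₁d, cutOff, if_neg he, if_neg heA]
        linarith [lt_of_le_of_ne (hmax e t ht) hut]
  -- the ratio of the coefficients of the two pieces makes the mean vanish
  set s := -(Γ.total G₁ / Γ.total G₂) with hs
  refine ⟨_, _, _, hG₁.add_smul hG₂ s, ?_, ?_⟩
  · have cG₂ := hG₂.continuous
    rw [total_add hG₁.continuous (by fun_prop), total_const_mul, hs]
    field_simp; ring
  · have hsq : ∀ a b : E → ℝ → ℝ, (∀ e, Continuous (a e)) → (∀ e, Continuous (b e)) →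
        (∀ e t, a e t * b e t = 0) → Γ.total (fun e t => (a e t + s * b e t) ^ 2)
          = Γ.total (fun e t => a e t ^ 2) + s ^ 2 * Γ.total (fun e t => b e t ^ 2) := by
      intro a b ha hb hab
      rw [← total_const_mul, ← total_add (by fun_prop) (by fun_prop)]
      exact total_congr fun e t => by linear_combination 2 * s * hab e t
    rw [hsq G₁ G₂ hG₁.continuous hG₂.continuous (fun e t => by
        rcases hor e t with ⟨h1, -⟩ | ⟨h1, -⟩ <;> simp only [hG₂d, h1] <;> ring),
      hsq P₁ P₂ hG₁.cont hG₂.cont (fun e t => by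
        rcases hor e t with ⟨-, h1⟩ | ⟨-, h1⟩ <;> simp only [hP₂d, h1] <;> ring), hE₁, hE₂]
    have h1 : 0 < μ * M * Γ.total G₁ := by positivity
    have h2 : 0 ≤ s ^ 2 * (μ * M * Γ.total G₂) := by positivity
    linarith

end

section

variable {V E : Type*} {Γ : MetricGraph V E} [Fintype E]

/-! ### Maxima lie on the boundary -/

theorem nonpos_of_hasDerivAt_of_le {g : ℝ → ℝ} {g' a b : ℝ} (hab : a < b) (hg : HasDerivAt g g' a)
    (hle : ∀ t ∈ Set.Icc a b, g t ≤ g a) : g' ≤ 0 := by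
  refine le_of_tendsto ((hasDerivWithinAt_iff_tendsto_slope' (s := Set.Ioi a)
    (lt_irrefl a)).1 hg.hasDerivWithinAt) ?_
  filter_upwards [Ioc_mem_nhdsGT hab] with t ht
  rw [slope_def_field]
  exact div_nonpos_of_nonpos_of_nonneg (sub_nonpos.2 (hle t ⟨ht.1.le, ht.2⟩))
    (sub_nonneg.2 ht.1.le)

theorem nonneg_of_hasDerivAt_of_le {g : ℝ → ℝ} {g' a b : ℝ} (hab : a < b) (hg : HasDerivAt g g' b)
    (hle : ∀ t ∈ Set.Icc a b, g t ≤ g b) : 0 ≤ g' := by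
  refine ge_of_tendsto ((hasDerivWithinAt_iff_tendsto_slope' (s := Set.Iio b)
    (lt_irrefl b)).1 hg.hasDerivWithinAt) ?_
  filter_upwards [Ico_mem_nhdsLT hab] with t ht
  rw [slope_def_field]
  exact div_nonneg_of_nonpos (sub_nonpos.2 (hle t ⟨ht.1, ht.2.le⟩)) (sub_nonpos.2 ht.2.le)

/-- At a maximum at a vertex all outgoing derivatives vanish: they are nonpositive with sum zero. -/
theorem Solves.deriv_eq_zero_of_max {μ : ℝ} {φ : V → ℝ} {u p : E → ℝ → ℝ}
    (h : Γ.Solves μ (fun _ _ => 0) φ u p) {v : V}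
    (hmax : ∀ e, ∀ t ∈ Set.Icc 0 (Γ.len e), u e t ≤ φ v) :
    (∀ e, Γ.src e = v → p e 0 = 0) ∧ ∀ e, Γ.tgt e = v → p e (Γ.len e) = 0 := by
  classical
  have hs : ∀ e, Γ.src e = v → p e 0 ≤ 0 := fun e he =>
    nonpos_of_hasDerivAt_of_le (Γ.len_pos e) (h.hasDeriv e 0) fun t ht => by
      rw [h.src, he]; exact hmax e t ht
  have ht : ∀ e, Γ.tgt e = v → -p e (Γ.len e) ≤ 0 := fun e he =>
    neg_nonpos.2 <| nonneg_of_hasDerivAt_of_le (Γ.len_pos e) (h.hasDeriv e _) fun t ht => by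
      rw [h.tgt, he]; exact hmax e t ht
  have hs' : ∀ e ∈ Finset.univ.filter (fun e => Γ.src e = v), p e 0 ≤ 0 := fun e he =>
    hs e (Finset.mem_filter.1 he).2
  have ht' : ∀ e ∈ Finset.univ.filter (fun e => Γ.tgt e = v), -p e (Γ.len e) ≤ 0 := fun e he =>
    ht e (Finset.mem_filter.1 he).2
  have hk : (∑ e with Γ.src e = v, p e 0) + (∑ e with Γ.tgt e = v, -(p e (Γ.len e))) = 0 := by
    convert h.kirchhoff v
  have h1 := Finset.sum_nonpos hs'
  have h2 := Finset.sum_nonpos ht'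
  constructor
  · intro e he
    exact (Finset.sum_eq_zero_iff_of_nonpos hs').1 (by linarith) e (by simp [he])
  · intro e he
    exact neg_eq_zero.1 ((Finset.sum_eq_zero_iff_of_nonpos ht').1 (by linarith) e (by simp [he]))

/-- In a graph without loops a vertex with exactly one incident edge has degree one. -/
theorem degree_eq_one (hl : ∀ e, Γ.src e ≠ Γ.tgt e) {v : V} {e₀ : E}
    (he₀ : Γ.src e₀ = v ∨ Γ.tgt e₀ = v)
    (h : ∀ e, e ≠ e₀ → Γ.src e ≠ v ∧ Γ.tgt e ≠ v) : Γ.degree v = 1 := by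
  classical
  have hcard : ∀ {s : E → V}, (∀ e, e ≠ e₀ → s e ≠ v) →
      (Finset.univ.filter (fun e => s e = v)).card = if s e₀ = v then 1 else 0 := by
    intro s hs
    split_ifs with h0
    · rw [Finset.card_eq_one]
      refine ⟨e₀, Finset.ext fun e => ?_⟩
      simp only [Finset.mem_filter, Finset.mem_univ, true_and, Finset.mem_singleton]
      exact ⟨fun he => by_contra fun hne => hs e hne he, fun he => he ▸ h0⟩
    · rw [Finset.card_eq_zero]
      refine Finset.filter_eq_empty_iff.2 fun e _ he => ?_
      by_cases hne : e = e₀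
      exacts [h0 (hne ▸ he), hs e hne he]
  have h1 := hcard fun e he => (h e he).1
  have h2 := hcard fun e he => (h e he).2
  have hdeg : Γ.degree v = (Finset.univ.filter (fun e => Γ.src e = v)).card +
      (Finset.univ.filter (fun e => Γ.tgt e = v)).card := by
    unfold degree
    congr!
  rw [hdeg, h1, h2]
  rcases he₀ with he | he
  · rw [if_pos he, if_neg fun h' => hl e₀ (he.trans h'.symm)]
  · rw [if_neg fun h' => hl e₀ (h'.trans he.symm), if_pos he]

/-- A maximum off the boundary would separate the tree into two nondegenerate sides, with vanishing
derivative at the cut, and so produce an eigenvalue below `μ`. -/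
theorem Solves.mem_boundary_of_max [Fintype V] (hΓ : Γ.IsTree) {μ : ℝ} (hμ : 0 < μ)
    (hleast : ∀ ν, 0 < ν → ν < μ → ¬ ∃ f, Γ.IsEigenfunction ν f) {φ : V → ℝ} {u p : E → ℝ → ℝ}
    (h : Γ.Solves μ (fun _ _ => 0) φ u p) (hne : ∃ e, ∃ t ∈ Set.Icc 0 (Γ.len e), u e t ≠ 0)
    {x : Γ.Point} (hx : ∀ y : Γ.Point, glue φ u y ≤ glue φ u x) : x ∈ Γ.boundary := by
  have hmax : ∀ e, ∀ t ∈ Set.Icc 0 (Γ.len e), u e t ≤ glue φ u x := fun e t ht => by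
    rw [← h.glue_onEdge e ht]; exact hx _
  obtain ⟨e', -⟩ := id hne
  have hconn : Γ.toSimpleGraph.Connected := hΓ.isTree.connected
  have hinc := exists_incident hconn e'
  have key : ∀ (e₀ : E) (A : Set V), Γ.src e₀ ∈ A → Γ.tgt e₀ ∉ A →
      (∀ e, e ≠ e₀ → (Γ.src e ∈ A ↔ Γ.tgt e ∈ A)) → ∀ a ∈ Set.Icc 0 (Γ.len e₀),
      u e₀ a = glue φ u x → p e₀ a = 0 → (0 < a ∨ ∃ e, e ≠ e₀ ∧ Γ.src e ∈ A) →
      ¬ (a < Γ.len e₀ ∨ ∃ e, e ≠ e₀ ∧ Γ.src e ∉ A) := by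
    intro e₀ A hs ht hA a ha hua hpa h₁ h₂
    obtain ⟨ψ, w, q, hw, hw0, hlt⟩ :=
      h.exists_trial hμ hne hs ht hA ha (by rwa [hua]) hpa h₁ h₂
    obtain ⟨ν, hν, hνμ, hf⟩ := exists_isEigenfunction_lt hconn hinc hμ hw hw0 hlt
    exact hleast ν hν hνμ hf
  cases x with
  | inner e t h0 h1 =>
    obtain ⟨A, hs, ht, hA⟩ := hΓ.exists_cut e
    have hp : p e t = 0 := by
      refine IsLocalMax.hasDerivAt_eq_zero ?_ (h.hasDeriv e t)
      filter_upwards [Icc_mem_nhds h0 h1] with s hs using hmax e s hs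
    exact absurd (Or.inl h1) (key e A hs ht hA t ⟨h0.le, h1.le⟩ rfl hp (Or.inl h0))
  | vertex v =>
    refine ⟨v, ?_, rfl⟩
    obtain ⟨hd₁, hd₂⟩ := h.deriv_eq_zero_of_max hmax
    obtain ⟨e₀, he₀⟩ := hinc v
    refine degree_eq_one hΓ.no_loops he₀ ?_
    by_contra! hc
    obtain ⟨e, he, hev⟩ := hc
    replace hev : Γ.src e = v ∨ Γ.tgt e = v := or_iff_not_imp_left.2 hev
    obtain ⟨A, hs, ht, hA⟩ := hΓ.exists_cut e₀
    rcases he₀ with rfl | rfl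
    · refine key e₀ A hs ht hA 0 (Set.left_mem_Icc.2 (Γ.len_pos e₀).le) (h.src e₀) (hd₁ e₀ rfl)
        (Or.inr ⟨e, he, ?_⟩) (Or.inl (Γ.len_pos e₀))
      rcases hev with hev | hev
      · rwa [hev]
      · rwa [hA e he, hev]
    · refine key e₀ A hs ht hA _ (Set.right_mem_Icc.2 (Γ.len_pos e₀).le) (h.tgt e₀) (hd₂ e₀ rfl)
        (Or.inl (Γ.len_pos e₀)) (Or.inr ⟨e, he, ?_⟩)
      rcases hev with hev | hev
      · rwa [hev]
      · rwa [hA e he, hev]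

theorem Solves.neg {μ : ℝ} {φ : V → ℝ} {u p : E → ℝ → ℝ} (h : Γ.Solves μ (fun _ _ => 0) φ u p) :
    Γ.Solves μ (fun _ _ => 0) (fun v => -φ v) (fun e t => -u e t) (fun e t => -p e t) where
  hasDeriv e t := (h.hasDeriv e t).neg
  cont e := (h.cont e).neg
  src e := by rw [h.src]
  tgt e := by rw [h.tgt]
  hasDeriv_p e t := (h.hasDeriv_p e t).neg.congr_deriv (by ring)
  kirchhoff v := by
    rw [Finset.sum_neg_distrib, Finset.sum_neg_distrib, ← neg_add, h.kirchhoff v, neg_zero]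

end

end MetricGraph

theorem mainTheorem1 {V E : Type*} [Fintype V] [Fintype E] (Γ : MetricGraph V E)
    (hΓ : Γ.IsTree) (μ : ℝ) (hμ : Γ.IsFirstPositiveEigenvalue μ)
    (f : Γ.Point → ℝ) (hf : Γ.IsEigenfunction μ f) :
    (∀ x, (∀ y, f y ≤ f x) → x ∈ Γ.boundary) ∧
      (∀ x, (∀ y, f x ≤ f y) → x ∈ Γ.boundary) := by
  obtain ⟨⟨hμ0, -⟩, hlb⟩ := hμ
  have hleast : ∀ ν, 0 < ν → ν < μ → ¬ ∃ f, Γ.IsEigenfunction ν f := fun ν h0 hlt hν =>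
    not_lt.2 (hlb ⟨h0, hν⟩) hlt
  obtain ⟨u, p, hsol, hfu, hne⟩ := hf.exists_solves hμ0
  have hglue : ∀ x, f x = MetricGraph.glue (fun v => f (.vertex v)) u x := by
    rintro (v | ⟨e, t, h0, h1⟩)
    · rfl
    · rw [MetricGraph.glue, ← hfu e t ⟨h0.le, h1.le⟩, MetricGraph.Point.onEdge, dif_pos h0,
        dif_pos h1]
  refine ⟨fun x hx => hsol.mem_boundary_of_max hΓ hμ0 hleast hne fun y => ?_,
    fun x hx => hsol.neg.mem_boundary_of_max hΓ hμ0 hleast ?_ fun y => ?_⟩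
  · rw [← hglue, ← hglue]; exact hx y
  · obtain ⟨e, t, ht, h⟩ := hne
    exact ⟨e, t, ht, neg_ne_zero.2 h⟩
  · have hneg : ∀ z, MetricGraph.glue (fun v => -f (.vertex v)) (fun e t => -u e t) z = -f z := by
      intro z
      rw [hglue]
      cases z <;> rfl
    rw [hneg, hneg]
    exact neg_le_neg (hx y)
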